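/- Let $\mathbb D$ be the open unit disc and let $(\phi_t)_{t\ge 0}$ be a continuous one-parameter semigroup of holomorphic self-maps of $\mathbb D$ (that is, $\phi_0=\mathrm{id}$, $\phi_{s+t}=\phi_s\circ\phi_t$, and $t\mapsto\phi_t$ is continuous for uniform convergence on compacta). Assume it is non-elliptic with Denjoy–Wolff point $\tau\in\partial\mathbb D$, i.e. $\phi_t\to\tau$ uniformly on compacta of $\mathbb D$ as $t\to+\infty$. Let $h$ be its Koenigs function, i.e. the univalent function on $\mathbb D$ (unique up to an additive constant) with $h(\phi_t(z))=h(z)+it$ for all $t\ge0$, $z\in\mathbb D$, and let $\Omega=h(\mathbb D)$. For $\beta\in(0,\pi/2)$ put $V(\beta,0)=\{\rho e^{i\theta}:\rho>0,\ |\theta|<\beta\}$. Suppose that there are $\beta\in(0,\pi/2)$ and $q\in\mathbb C$ with $q+iV(\beta,0)\subset\Omega$. Then for every $z\in\mathbb D$ the trajectory $\phi_t(z)$ converges non-tangentially to $\tau$ as $t\to+\infty$, that is, $\phi_t(z)\to\tau$ and, for some $R>1$ (depending on $z$), $|\tau-\phi_t(z)|<R(1-|\phi_t(z)|)$ for all sufficiently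 large $t$. Moreover, the slope of $(\phi_t)$ is a compact interval $[a,b]$ with $-\pi/2<a\le b<\pi/2$: there are such $a,b$ for which, for every $z\in\mathbb D$, the set of cluster points of $\mathrm{Arg}(1-\overline{\tau}\phi_t(z))$ as $t\to+\infty$ equals $[a,b]$. -/

import Mathlib

open scoped NNReal

namespace DiscSemigroup

open Filter Topology

/-- The open unit disc of `ℂ`. -/
abbrev disc : Set ℂ := Metric.ball (0 : ℂ) 1

/-- `φ` (restricted to the unit disc) is a one-parameter continuous semigroup of holomorphic
self-maps of the unit disc: a homomorphism from `([0,+∞), +)` to the holomorphic self-maps of the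
disc under composition, continuous for the topology of uniform convergence on compacta. -/
structure IsSemigroup (φ : ℝ≥0 → ℂ → ℂ) : Prop where
  holo : ∀ t, DifferentiableOn ℂ (φ t) disc
  mapsTo : ∀ t, Set.MapsTo (φ t) disc disc
  zero : ∀ z ∈ disc, φ 0 z = z
  add : ∀ s t, ∀ z ∈ disc, φ (s + t) z = φ s (φ t z)
  cont : ∀ t₀, TendstoLocallyUniformlyOn φ (φ t₀) (𝓝 t₀) disc

/-- `τ` is the Denjoy–Wolff point of `(φ_t)`: a point of the closed unit disc such that
`φ_t → τ` uniformly on compact subsets of the disc as `t → +∞`. -/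
def IsDenjoyWolffPoint (φ : ℝ≥0 → ℂ → ℂ) (τ : ℂ) : Prop :=
  τ ∈ Metric.closedBall (0 : ℂ) 1 ∧ TendstoLocallyUniformlyOn φ (fun _ => τ) atTop disc

/-- The semigroup is non-elliptic: its Denjoy–Wolff point lies on the unit circle. -/
def IsNonElliptic (φ : ℝ≥0 → ℂ → ℂ) : Prop :=
  ∃ τ ∈ Metric.sphere (0 : ℂ) 1, IsDenjoyWolffPoint φ τ

/-- `h` is a Koenigs function of the (non-elliptic) semigroup `(φ_t)`: `h` is univalent on the disc
and `h ∘ φ_t = h + i t`. Such an `h` is unique up to an additive constant. That the image is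
starlike at infinity, and that the union of its translates by `- i t` is a vertical strip, a
vertical half-plane or the whole plane, follows from these conditions. -/
structure IsKoenigs (φ : ℝ≥0 → ℂ → ℂ) (h : ℂ → ℂ) : Prop where
  holo : DifferentiableOn ℂ h disc
  inj : Set.InjOn h disc
  conj : ∀ t : ℝ≥0, ∀ z ∈ disc, h (φ t z) = h z + Complex.I * ((t : ℝ) : ℂ)

/-- The horizontal sector `V(β, r₀) = {ρ e^{iθ} : ρ > r₀, |θ| < β}`. -/
def sector (β r₀ : ℝ) : Set ℂ :=
  {w | ∃ ρ θ : ℝ, r₀ < ρ ∧ |θ| < β ∧ w = (ρ : ℂ) * Complex.exp (Complex.I * (θ : ℂ))}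

/-- The Stolz region of vertex `σ` and amplitude `R`. -/
def stolz (σ : ℂ) (R : ℝ) : Set ℂ :=
  {z | z ∈ disc ∧ ‖σ - z‖ < R * (1 - ‖z‖)}

/-- The curve `γ` converges non-tangentially to the point `σ` of the unit circle as `t → +∞`. -/
def TendsToNonTangentially (γ : ℝ≥0 → ℂ) (σ : ℂ) : Prop :=
  σ ∈ Metric.sphere (0 : ℂ) 1 ∧ Tendsto γ atTop (𝓝 σ) ∧
    ∃ R : ℝ, 1 < R ∧ ∀ᶠ t in atTop, γ t ∈ stolz σ R

/-- The slope of the trajectory of `z`: the cluster set of `Arg (1 - τ̄ φ_t(z))` as `t → +∞`. -/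
def slope (φ : ℝ≥0 → ℂ → ℂ) (τ z : ℂ) : Set ℝ :=
  {a | MapClusterPt a atTop (fun t : ℝ≥0 => Complex.arg (1 - (starRingEnd ℂ) τ * φ t z))}

end DiscSemigroup

/-
The Cayley transform carries the disc to the right half-plane and `τ` to infinity. There the real
part increases along trajectories (Julia–Wolff). Since `Ω` contains discs of linearly growing radius
about the points `h z + i t`, the step between the times `t` and `l t` of a trajectory is bounded in
the hyperbolic metric, for some `l > 1`. On the other hand `Ω` omits a downward vertical half-line,
and the square root on the slit plane shows that the hyperbolic distance between the times `t` and
`lⁿ t` is at least of order `n log l`. For large `n` this is only possible if the real part at least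
doubles between these times. The steps are comparable to the real part, so they sum like a geometric
series and the trajectory stays in a sector of the half-plane, which is a Stolz region of the disc.
The discs also force `(1 - τ̄ φ_t(w)) / (1 - τ̄ φ_t(z)) → 1`, so all trajectories have the same
slope; it is an interval because the argument is continuous in `t`.
-/

namespace DiscSemigroup

open ComplexConjugate Filter Metric Set Topology
open Complex (I)

section SchwarzPick

lemma one_sub_norm_sq_pos {z : ℂ} (hz : z ∈ disc) : 0 < 1 - ‖z‖ ^ 2 :=
  sub_pos.2 (pow_lt_one₀ (norm_nonneg z) (mem_ball_zero_iff.1 hz) two_ne_zero)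

lemma one_sub_conj_mul_ne_zero {w z : ℂ} (hw : ‖w‖ ≤ 1) (hz : z ∈ disc) :
    1 - conj w * z ≠ 0 := by
  refine sub_ne_zero.2 fun h1 => ?_
  have hlt : ‖conj w * z‖ < 1 := by
    rw [norm_mul, RCLike.norm_conj]
    exact mul_lt_one_of_nonneg_of_lt_one_right hw (norm_nonneg z) (mem_ball_zero_iff.1 hz)
  rw [← h1, norm_one] at hlt
  exact lt_irrefl 1 hlt

lemma norm_one_sub_conj_mul_sq (z w : ℂ) :
    ‖1 - conj w * z‖ ^ 2 = ‖z - w‖ ^ 2 + (1 - ‖z‖ ^ 2) * (1 - ‖w‖ ^ 2) := by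
  simp only [Complex.sq_norm, Complex.normSq_apply, Complex.sub_re, Complex.sub_im,
    Complex.mul_re, Complex.mul_im, Complex.conj_re, Complex.conj_im, Complex.one_re,
    Complex.one_im]
  ring

/-- The holomorphic automorphism of the unit disc that sends `w` to `0`; its inverse is
`moebius (-w)`. -/
noncomputable def moebius (w z : ℂ) : ℂ := (z - w) / (1 - conj w * z)

lemma norm_moebius_sq (w z : ℂ) :
    ‖moebius w z‖ ^ 2 = ‖z - w‖ ^ 2 / (‖z - w‖ ^ 2 + (1 - ‖z‖ ^ 2) * (1 - ‖w‖ ^ 2)) := by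
  rw [moebius, norm_div, div_pow, norm_one_sub_conj_mul_sq]

lemma mapsTo_moebius {w : ℂ} (hw : w ∈ disc) : MapsTo (moebius w) disc disc := by
  intro z hz
  have hpos := mul_pos (one_sub_norm_sq_pos hz) (one_sub_norm_sq_pos hw)
  have hlt : ‖moebius w z‖ ^ 2 < 1 := by
    rw [norm_moebius_sq, div_lt_one (by positivity)]
    exact lt_add_of_pos_right _ hpos
  exact mem_ball_zero_iff.2 ((sq_lt_one_iff₀ (norm_nonneg _)).1 hlt)

lemma differentiableOn_moebius {w : ℂ} (hw : w ∈ disc) :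
    DifferentiableOn ℂ (moebius w) disc :=
  DifferentiableOn.div (by fun_prop) (by fun_prop) fun _ hz =>
    one_sub_conj_mul_ne_zero (mem_ball_zero_iff.1 hw).le hz

lemma moebius_neg_moebius {w z : ℂ} (hw : w ∈ disc) (hz : z ∈ disc) :
    moebius (-w) (moebius w z) = z := by
  have hw1 : ‖w‖ ≤ 1 := (mem_ball_zero_iff.1 hw).le
  have hwz := one_sub_conj_mul_ne_zero hw1 hz
  have hww := one_sub_conj_mul_ne_zero hw1 hw
  have hden : 1 + conj w * moebius w z = (1 - conj w * w) / (1 - conj w * z) := by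
    rw [moebius]
    field_simp
    ring
  rw [moebius, map_neg, neg_mul, sub_neg_eq_add, sub_neg_eq_add, hden,
    div_eq_iff (div_ne_zero hww hwz), moebius, div_add' _ _ _ hwz, mul_div_assoc',
    div_left_inj' hwz]
  ring

variable {f : ℂ → ℂ} {z w : ℂ}

theorem norm_moebius_map_le (hf : DifferentiableOn ℂ f disc) (hm : MapsTo f disc disc)
    (hz : z ∈ disc) (hw : w ∈ disc) : ‖moebius (f w) (f z)‖ ≤ ‖moebius w z‖ := by
  have hnw : -w ∈ disc := by simpa using hw
  let g : ℂ → ℂ := moebius (f w) ∘ f ∘ moebius (-w)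
  have hgm : MapsTo g disc disc := (mapsTo_moebius (hm hw)).comp (hm.comp (mapsTo_moebius hnw))
  have hgd : DifferentiableOn ℂ g disc :=
    (differentiableOn_moebius (hm hw)).comp (hf.comp (differentiableOn_moebius hnw)
      (mapsTo_moebius hnw)) (hm.comp (mapsTo_moebius hnw))
  have hg0 : g 0 = 0 := by simp [g, moebius]
  have := Complex.norm_le_norm_of_mapsTo_ball hgd (hgm.mono_right ball_subset_closedBall) hg0
    (mem_ball_zero_iff.1 (mapsTo_moebius hw hz))
  simpa only [g, Function.comp_apply, moebius_neg_moebius hw hz] using this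

/-- `sinh² (d / 2)`, where `d` is the hyperbolic distance of curvature `-1` between the points `z`
and `w` of the unit disc. This increasing function of `d` is the form in which hyperbolic distances
are compared here. -/
noncomputable def sinhSqHalfDist (z w : ℂ) : ℝ :=
  ‖z - w‖ ^ 2 / ((1 - ‖z‖ ^ 2) * (1 - ‖w‖ ^ 2))

theorem sinhSqHalfDist_map_le (hf : DifferentiableOn ℂ f disc) (hm : MapsTo f disc disc)
    (hz : z ∈ disc) (hw : w ∈ disc) :
    sinhSqHalfDist (f z) (f w) ≤ sinhSqHalfDist z w := by
  have hp := mul_pos (one_sub_norm_sq_pos hz) (one_sub_norm_sq_pos hw)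
  have hp' := mul_pos (one_sub_norm_sq_pos (hm hz)) (one_sub_norm_sq_pos (hm hw))
  have hle := pow_le_pow_left₀ (norm_nonneg _) (norm_moebius_map_le hf hm hz hw) 2
  rw [norm_moebius_sq, norm_moebius_sq, div_le_div_iff₀ (by positivity) (by positivity)] at hle
  rw [sinhSqHalfDist, sinhSqHalfDist, div_le_div_iff₀ hp' hp]
  linarith

end SchwarzPick

section Cayley

/-- The Cayley transform of the unit disc onto the right half-plane that sends the point `σ` of the
unit circle to infinity. -/
noncomputable def cayley (σ z : ℂ) : ℂ := (1 + conj σ * z) / (1 - conj σ * z)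

variable {σ z w : ℂ}

lemma norm_one_sub_conj_mul (hσ : ‖σ‖ = 1) (z : ℂ) : ‖1 - conj σ * z‖ = ‖σ - z‖ := by
  have h := norm_one_sub_conj_mul_sq z σ
  rw [hσ, one_pow, sub_self, mul_zero, add_zero, norm_sub_rev z σ] at h
  exact (pow_left_inj₀ (norm_nonneg _) (norm_nonneg _) two_ne_zero).1 h

lemma norm_sub_pos (hσ : ‖σ‖ = 1) (hz : z ∈ disc) : 0 < ‖σ - z‖ := by
  rw [← norm_one_sub_conj_mul hσ]
  exact norm_pos_iff.2 (one_sub_conj_mul_ne_zero hσ.le hz)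

lemma differentiableOn_cayley (hσ : ‖σ‖ = 1) : DifferentiableOn ℂ (cayley σ) disc :=
  DifferentiableOn.div (by fun_prop) (by fun_prop) fun _ hz => one_sub_conj_mul_ne_zero hσ.le hz

lemma cayley_add_one (hσ : ‖σ‖ = 1) (hz : z ∈ disc) :
    cayley σ z + 1 = 2 / (1 - conj σ * z) := by
  rw [cayley, div_add_one (one_sub_conj_mul_ne_zero hσ.le hz)]
  ring

lemma cayley_re (hσ : ‖σ‖ = 1) (z : ℂ) : (cayley σ z).re = (1 - ‖z‖ ^ 2) / ‖σ - z‖ ^ 2 := by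
  have hre (u : ℂ) : ((1 + u) / (1 - u)).re = (1 - ‖u‖ ^ 2) / ‖1 - u‖ ^ 2 := by
    simp only [Complex.div_re, Complex.sq_norm, ← add_div, Complex.normSq_apply, Complex.add_re,
      Complex.sub_re, Complex.add_im, Complex.sub_im, Complex.one_re, Complex.one_im]
    ring
  rw [cayley, hre, norm_one_sub_conj_mul hσ, norm_mul, RCLike.norm_conj, hσ, one_mul]

lemma cayley_re_pos (hσ : ‖σ‖ = 1) (hz : z ∈ disc) : 0 < (cayley σ z).re := by
  rw [cayley_re hσ]
  exact div_pos (one_sub_norm_sq_pos hz) (pow_pos (norm_sub_pos hσ hz) 2)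

lemma norm_cayley_sub (hσ : ‖σ‖ = 1) (hz : z ∈ disc) (hw : w ∈ disc) :
    ‖cayley σ z - cayley σ w‖ = 2 * ‖z - w‖ / (‖σ - z‖ * ‖σ - w‖) := by
  have hz0 := one_sub_conj_mul_ne_zero hσ.le hz
  have hw0 := one_sub_conj_mul_ne_zero hσ.le hw
  have hsub : cayley σ z - cayley σ w =
      2 * conj σ * (z - w) / ((1 - conj σ * z) * (1 - conj σ * w)) := by
    rw [cayley, cayley]
    field_simp
    ring
  rw [hsub, norm_div, norm_mul, norm_mul, norm_mul, RCLike.norm_conj, hσ,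
    norm_one_sub_conj_mul hσ, norm_one_sub_conj_mul hσ, Complex.norm_ofNat, mul_one]

lemma sinhSqHalfDist_eq_cayley (hσ : ‖σ‖ = 1) (hz : z ∈ disc) (hw : w ∈ disc) :
    sinhSqHalfDist z w =
      ‖cayley σ z - cayley σ w‖ ^ 2 / (4 * (cayley σ z).re * (cayley σ w).re) := by
  have hz0 := norm_sub_pos hσ hz
  have hw0 := norm_sub_pos hσ hw
  have hz1 := one_sub_norm_sq_pos hz
  have hw1 := one_sub_norm_sq_pos hw
  rw [sinhSqHalfDist, norm_cayley_sub hσ hz hw, cayley_re hσ, cayley_re hσ]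
  field_simp
  norm_num

theorem norm_sub_sq_div_le_sinhSqHalfDist {f : ℂ → ℂ} (hf : DifferentiableOn ℂ f disc)
    (hpos : ∀ z ∈ disc, 0 < (f z).re) (hz : z ∈ disc) (hw : w ∈ disc) :
    ‖f z - f w‖ ^ 2 / (4 * (f z).re * (f w).re) ≤ sinhSqHalfDist z w := by
  let g : ℂ → ℂ := fun z => (f z - 1) / (f z + 1)
  have hne {z : ℂ} (hz : z ∈ disc) : f z + 1 ≠ 0 := fun h0 => by
    have := congrArg Complex.re h0
    simp only [Complex.add_re, Complex.one_re, Complex.zero_re] at this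
    linarith [hpos z hz]
  have hgd : DifferentiableOn ℂ g disc := (hf.sub_const 1).div (hf.add_const 1) fun _ => hne
  have hgm : MapsTo g disc disc := by
    intro z hz
    have hlt : ‖f z - 1‖ ^ 2 < ‖f z + 1‖ ^ 2 := by
      simp only [Complex.sq_norm, Complex.normSq_apply, Complex.sub_re, Complex.sub_im,
        Complex.add_re, Complex.add_im, Complex.one_re, Complex.one_im]
      linarith [hpos z hz]
    rw [mem_ball_zero_iff, norm_div, div_lt_one (norm_pos_iff.2 (hne hz))]
    exact lt_of_pow_lt_pow_left₀ 2 (norm_nonneg _) hlt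
  have hcg {z : ℂ} (hz : z ∈ disc) : cayley 1 (g z) = f z := by
    have h0 := hne hz
    simp only [cayley, map_one, one_mul, g]
    rw [one_add_div h0, one_sub_div h0, div_div_div_cancel_right₀ h0]
    ring
  have hle := sinhSqHalfDist_map_le hgd hgm hz hw
  rwa [sinhSqHalfDist_eq_cayley norm_one (hgm hz) (hgm hw), hcg hz, hcg hw] at hle

end Cayley

section Harnack

theorem norm_sub_le_of_re_pos {f : ℂ → ℂ} {c z : ℂ} {R : ℝ} (hf : DifferentiableOn ℂ f (ball c R))
    (hpos : ∀ z ∈ ball c R, 0 < (f z).re) (hz : z ∈ ball c R) :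
    ‖f z - f c‖ ≤ 2 * (f c).re * ‖z - c‖ / (R - ‖z - c‖) := by
  have hR : 0 < R := pos_of_mem_ball hz
  have hadd : MapsTo (c + ·) (ball 0 R) (ball c R) := fun ζ hζ => by simpa using hζ
  have hle := Complex.borelCaratheodory_zero (f := fun ζ => f c - f (c + ζ)) (z := z - c)
    (hpos c (mem_ball_self hR)) ((hf.comp (by fun_prop) hadd).const_sub (f c))
    (fun ζ hζ => by simpa using (hpos _ (hadd hζ)).le) hR
    (by rwa [mem_ball_zero_iff, ← mem_ball_iff_norm]) (by simp)
  rwa [add_sub_cancel, norm_sub_rev] at hle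

end Harnack

section InverseOfUnivalent

variable {h : ℂ → ℂ} {U : Set ℂ} {z : ℂ}

lemma not_eventually_eq_of_injOn (hi : InjOn h U) (hU : U ∈ 𝓝 z) :
    ¬ ∀ᶠ w in 𝓝 z, h w = h z := by
  intro hc
  have heq : ∀ᶠ w in 𝓝[≠] z, w = z := by
    filter_upwards [nhdsWithin_le_nhds hc, nhdsWithin_le_nhds hU] with w hw hwU
    exact hi hwU (mem_of_mem_nhds hU) hw
  obtain ⟨w, hw, hne⟩ := (heq.and self_mem_nhdsWithin).exists
  exact hne hw

lemma eventually_deriv_ne_zero_of_injOn (hd : DifferentiableOn ℂ h U) (hi : InjOn h U)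
    (hU : U ∈ 𝓝 z) : ∀ᶠ w in 𝓝[≠] z, deriv h w ≠ 0 := by
  refine (hd.analyticAt hU).deriv.eventually_eq_zero_or_eventually_ne_zero.resolve_left fun h0 => ?_
  obtain ⟨r, hr, hball⟩ := Metric.eventually_nhds_iff_ball.1 (h0.and hU)
  refine not_eventually_eq_of_injOn hi hU
    (Metric.eventually_nhds_iff_ball.2 ⟨r, hr, fun w hw => ?_⟩)
  exact isOpen_ball.is_const_of_deriv_eq_zero (convex_ball z r).isPreconnected
    (hd.mono fun v hv => (hball v hv).2) (fun v hv => (hball v hv).1) hw (mem_ball_self hr)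

theorem exists_openPartialHomeomorph_of_injOn (hU : IsOpen U) (hd : DifferentiableOn ℂ h U)
    (hi : InjOn h U) : ∃ e : OpenPartialHomeomorph ℂ ℂ, e.source = U ∧ ⇑e = h := by
  have hopen : IsOpenMap (U.domRestrict h) := IsOpenMap.of_nhds_le fun z => by
    have hz : U ∈ 𝓝 (z : ℂ) := hU.mem_nhds z.2
    have hle := (hd.analyticAt hz).eventually_constant_or_nhds_le_map_nhds.resolve_left
      (not_eventually_eq_of_injOn hi hz)
    rwa [← map_nhds_subtype_coe_eq_nhds z.2 hz, map_map] at hle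
  exact ⟨.ofContinuousOpenRestrict (hi.bijOn_image.toPartialEquiv h U (h '' U))
    hd.continuousOn hopen hU, rfl, rfl⟩

theorem differentiableOn_symm {e : OpenPartialHomeomorph ℂ ℂ}
    (hd : DifferentiableOn ℂ e e.source) : DifferentiableOn ℂ e.symm e.target := by
  intro w hw
  have hz : e.source ∈ 𝓝 (e.symm w) := e.open_source.mem_nhds (e.map_target hw)
  have htarget : ∀ᶠ v in 𝓝[≠] w, v ∈ e.target :=
    nhdsWithin_le_nhds (e.open_target.mem_nhds hw)
  have hne : ∀ᶠ v in 𝓝[≠] w, e.symm v ∈ ({e.symm w}ᶜ : Set ℂ) := by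
    filter_upwards [htarget, self_mem_nhdsWithin] with v hv hvw heq
    exact hvw (e.symm.injOn hv hw heq)
  have htendsto : Tendsto e.symm (𝓝[≠] w) (𝓝[≠] (e.symm w)) :=
    tendsto_nhdsWithin_iff.2 ⟨(e.symm.continuousAt hw).mono_left nhdsWithin_le_nhds, hne⟩
  have hpunctured : ∀ᶠ v in 𝓝[≠] w, DifferentiableAt ℂ e.symm v := by
    filter_upwards [htendsto.eventually (eventually_deriv_ne_zero_of_injOn hd e.injOn hz), htarget]
      with v hv hvt
    have hdv : DifferentiableAt ℂ e (e.symm v) :=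
      hd.differentiableAt (e.open_source.mem_nhds (e.map_target hvt))
    exact (e.hasDerivAt_symm hvt hv hdv.hasDerivAt).differentiableAt
  exact (Complex.analyticAt_of_differentiable_on_punctured_nhds_of_continuousAt hpunctured
    (e.symm.continuousAt hw)).differentiableAt.differentiableWithinAt

theorem norm_sub_le_of_re_pos_of_injOn {f : ℂ → ℂ} {w : ℂ} {R : ℝ} (hU : IsOpen U)
    (hd : DifferentiableOn ℂ h U) (hi : InjOn h U) (hf : DifferentiableOn ℂ f U)
    (hpos : ∀ z ∈ U, 0 < (f z).re) (hball : ball (h w) R ⊆ h '' U) (hz : z ∈ U) (hw : w ∈ U)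
    (hzw : ‖h z - h w‖ < R) :
    ‖f z - f w‖ ≤ 2 * (f w).re * ‖h z - h w‖ / (R - ‖h z - h w‖) := by
  obtain ⟨e, rfl, rfl⟩ := exists_openPartialHomeomorph_of_injOn hU hd hi
  rw [e.image_source_eq_target] at hball
  have hmaps : MapsTo e.symm (ball (e w) R) e.source := e.mapsTo_symm.mono_left hball
  have hle := norm_sub_le_of_re_pos (f := f ∘ e.symm)
    (hf.comp ((differentiableOn_symm hd).mono hball) hmaps) (fun v hv => hpos _ (hmaps hv))
    (mem_ball_iff_norm.2 hzw)
  simpa only [Function.comp_apply, e.left_inv hz, e.left_inv hw] using hle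

end InverseOfUnivalent

section ClusterSets

variable {α β : Type*} {l : Filter α} {y : β}

theorem setOf_mapClusterPt_eq_Icc [TopologicalSpace α] [ConditionallyCompleteLinearOrder β]
    [TopologicalSpace β] [OrderTopology β] [l.NeBot] {ι : Sort*} {p : ι → Prop}
    {s : ι → Set α} (hl : l.HasBasis p s) (hs : ∀ i, p i → IsPreconnected (s i)) {f : α → β}
    (hf : Continuous f) (hle : l.IsBoundedUnder (· ≤ ·) f) (hge : l.IsBoundedUnder (· ≥ ·) f) :
    {y | MapClusterPt y l f} = Icc (liminf f l) (limsup f l) := by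
  have hcole := hge.isCoboundedUnder_le
  have hcoge := hle.isCoboundedUnder_ge
  refine Subset.antisymm (fun y hy => ⟨hy.liminf_le hge, hy.le_limsup hle⟩) fun y hy => ?_
  rcases hy.1.eq_or_lt with rfl | hlow
  · exact .liminf hcoge hge
  rcases hy.2.eq_or_lt with rfl | hupp
  · exact .limsup hcole hle
  have hfreq : ∃ᶠ t in l, f t = y := hl.frequently_iff.2 fun i hi => by
    obtain ⟨u, hu, hufy⟩ := hl.frequently_iff.1 (frequently_lt_of_liminf_lt hcoge hlow) i hi
    obtain ⟨v, hv, hvfy⟩ := hl.frequently_iff.1 (frequently_lt_of_lt_limsup hcole hupp) i hi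
    exact (hs i hi).intermediate_value hu hv hf.continuousOn ⟨hufy.le, hvfy.le⟩
  exact mapClusterPt_iff_frequently.2 fun V hV => hfreq.mono fun t ht =>
    (congrArg (· ∈ V) ht).mpr (mem_of_mem_nhds hV)

theorem mapClusterPt_congr_of_tendsto_sub [TopologicalSpace β] [AddCommGroup β]
    [IsTopologicalAddGroup β] {f g : α → β} (hfg : Tendsto (fun t => f t - g t) l (𝓝 0)) :
    MapClusterPt y l f ↔ MapClusterPt y l g := by
  simp only [mapClusterPt_iff_ultrafilter]
  refine exists_congr fun V => and_congr_right fun hV => ⟨fun h => ?_, fun h => ?_⟩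
  · simpa using h.sub (hfg.mono_left hV)
  · simpa using h.add (hfg.mono_left hV)

end ClusterSets

section Doubling

variable {E : Type*} [PseudoMetricSpace E]

lemma dist_le_natCast_mul_of_monotone {a : ℕ → E} {x : ℕ → ℝ} (hx : Monotone x)
    (hstep : ∀ k, dist (a k) (a (k + 1)) ≤ x k) (k n : ℕ) :
    dist (a k) (a (k + n)) ≤ n * x (k + n) :=
  calc dist (a k) (a (k + n)) ≤ ∑ i ∈ Finset.Ico k (k + n), x i :=
        dist_le_Ico_sum_of_dist_le (Nat.le_add_right k n) fun _ _ => hstep _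
    _ ≤ (Finset.Ico k (k + n)).card • x (k + n) :=
        Finset.sum_le_card_nsmul _ _ _ fun _ hi => hx (Finset.mem_Ico.1 hi).2.le
    _ = n * x (k + n) := by rw [Nat.card_Ico, add_tsub_cancel_left, nsmul_eq_mul]

lemma dist_zero_le_of_doubling {a : ℕ → E} {x : ℕ → ℝ} (hx : Monotone x)
    (hstep : ∀ k, dist (a k) (a (k + 1)) ≤ x k) {n : ℕ} (hn : 0 < n)
    (hdouble : ∀ k, 2 * x k ≤ x (k + n)) (k : ℕ) : dist (a 0) (a k) ≤ 2 * n * x k := by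
  induction k using Nat.strong_induction_on with
  | _ k ih =>
    rcases lt_or_ge k n with hk | hk
    · calc dist (a 0) (a k) ≤ k * x k := by
            simpa using dist_le_natCast_mul_of_monotone hx hstep 0 k
        _ ≤ (2 * n : ℝ) * x k := by
            have hxk : 0 ≤ x k := dist_nonneg.trans (hstep k)
            gcongr
            exact_mod_cast hk.le.trans (Nat.le_mul_of_pos_left n two_pos)
    · obtain ⟨j, rfl⟩ := Nat.exists_eq_add_of_le' hk
      calc dist (a 0) (a (j + n)) ≤ dist (a 0) (a j) + dist (a j) (a (j + n)) := dist_triangle _ _ _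
        _ ≤ 2 * n * x j + n * x (j + n) :=
            add_le_add (ih j (by lia)) (dist_le_natCast_mul_of_monotone hx hstep j n)
        _ = n * (2 * x j) + n * x (j + n) := by ring
        _ ≤ n * x (j + n) + n * x (j + n) := by gcongr; exact hdouble j
        _ = 2 * n * x (j + n) := by ring

variable {G : ℝ≥0 → E} {x : ℝ≥0 → ℝ} {t₀ l : ℝ≥0}

lemma dist_le_natCast_mul_of_pow_mul (hx : Monotone x) (hl : 1 < l)
    (hstep : ∀ t ≥ t₀, ∀ s ∈ Icc t (l * t), dist (G t) (G s) ≤ x t) {t : ℝ≥0} (ht : t₀ ≤ t)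
    (n : ℕ) : dist (G t) (G (l ^ n * t)) ≤ n * x (l ^ n * t) := by
  have hmono : Monotone fun k : ℕ => l ^ k * t := (pow_right_mono₀ hl.le).mul_const zero_le
  have hle := dist_le_natCast_mul_of_monotone (a := fun k => G (l ^ k * t)) (hx.comp hmono)
    (fun k => hstep _ (ht.trans (by simpa using hmono (Nat.zero_le k))) _
      ⟨hmono k.le_succ, by rw [pow_succ', mul_assoc]⟩) 0 n
  simpa only [Function.comp_apply, pow_zero, one_mul, zero_add] using hle

theorem dist_le_of_doubling (hx : Monotone x) (ht₀ : 0 < t₀) (hl : 1 < l)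
    (hstep : ∀ t ≥ t₀, ∀ s ∈ Icc t (l * t), dist (G t) (G s) ≤ x t) {n : ℕ} (hn : 0 < n)
    (hdouble : ∀ t ≥ t₀, 2 * x t ≤ x (l ^ n * t)) {t : ℝ≥0} (ht : t₀ ≤ t) :
    dist (G t₀) (G t) ≤ (2 * n + 1) * x t := by
  have hmono : Monotone fun k : ℕ => l ^ k * t₀ := (pow_right_mono₀ hl.le).mul_const zero_le
  have hge (k : ℕ) : t₀ ≤ l ^ k * t₀ := by simpa using hmono (Nat.zero_le k)
  have hgrid (k : ℕ) : dist (G t₀) (G (l ^ k * t₀)) ≤ 2 * n * x (l ^ k * t₀) := by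
    have hle := dist_zero_le_of_doubling (a := fun k => G (l ^ k * t₀)) (hx.comp hmono)
      (fun k => hstep _ (hge k) _ ⟨hmono k.le_succ, by rw [pow_succ', mul_assoc]⟩) hn
      (fun k => by simpa [pow_add, mul_comm, mul_left_comm] using hdouble _ (hge k)) k
    simpa only [Function.comp_apply, pow_zero, one_mul] using hle
  obtain ⟨k, hkt, htk⟩ := exists_nat_pow_near ((one_le_div₀ ht₀).2 ht) hl
  rw [le_div_iff₀ ht₀] at hkt
  rw [div_lt_iff₀ ht₀, pow_succ', mul_assoc] at htk
  calc dist (G t₀) (G t) ≤ dist (G t₀) (G (l ^ k * t₀)) + dist (G (l ^ k * t₀)) (G t) :=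
        dist_triangle _ _ _
    _ ≤ 2 * n * x (l ^ k * t₀) + x (l ^ k * t₀) :=
        add_le_add (hgrid k) (hstep _ (hge k) _ ⟨hkt, htk.le⟩)
    _ = (2 * n + 1) * x (l ^ k * t₀) := by ring
    _ ≤ (2 * n + 1) * x t := by gcongr; exact hx hkt

end Doubling

section JuliaWolff

variable {f : ℂ → ℂ} {φ : ℝ≥0 → ℂ → ℂ} {τ z : ℂ}

lemma frequently_le_succ_of_tendsto {α : Type*} [LinearOrder α] [TopologicalSpace α]
    [OrderClosedTopology α] {u : ℕ → α} {L : α} (hu : Tendsto u atTop (𝓝 L)) (hlt : ∀ n, u n < L) :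
    ∃ᶠ n in atTop, u n ≤ u (n + 1) := by
  intro hev
  obtain ⟨N, hN⟩ := eventually_atTop.1 hev
  have hanti : Antitone fun n => u (n + N) := antitone_nat_of_succ_le fun n => by
    simpa only [add_right_comm] using (not_le.1 (hN (n + N) (Nat.le_add_left N n))).le
  exact (hlt (0 + N)).not_ge (hanti.le_of_tendsto ((tendsto_add_atTop_iff_nat N).2 hu) 0)

/-- The modulus of the iterates `a n` of `z₀` tends to `1` from below, so it fails to decrease
infinitely often; along such `n` the Schwarz–Pick inequality for `z` and `a n` passes to the
limit. -/
theorem cayley_re_le_cayley_re_map (hf : DifferentiableOn ℂ f disc) (hm : MapsTo f disc disc)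
    (hτ : ‖τ‖ = 1) {z₀ : ℂ} (hz₀ : z₀ ∈ disc) (hlim : Tendsto (fun n => f^[n] z₀) atTop (𝓝 τ))
    (hz : z ∈ disc) : (cayley τ z).re ≤ (cayley τ (f z)).re := by
  let a : ℕ → ℂ := fun n => f^[n] z₀
  have ha (n : ℕ) : a n ∈ disc := hm.iterate n hz₀
  have hfreq : ∃ᶠ n in atTop, ‖a n‖ ≤ ‖a (n + 1)‖ :=
    frequently_le_succ_of_tendsto (by simpa only [hτ] using hlim.norm) fun n =>
      mem_ball_zero_iff.1 (ha n)
  have htend (w : ℂ) {b : ℕ → ℂ} (hb : Tendsto b atTop (𝓝 τ)) :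
      Tendsto (fun n => ‖w - b n‖ ^ 2 / (1 - ‖w‖ ^ 2)) atTop (𝓝 (‖w - τ‖ ^ 2 / (1 - ‖w‖ ^ 2))) :=
    ((hb.const_sub w).norm.pow 2).div_const _
  have hle : ‖f z - τ‖ ^ 2 / (1 - ‖f z‖ ^ 2) ≤ ‖z - τ‖ ^ 2 / (1 - ‖z‖ ^ 2) := by
    refine le_of_tendsto_of_tendsto_of_frequently
      (htend (f z) (hlim.comp (tendsto_add_atTop_nat 1))) (htend z hlim) (hfreq.mono fun n hn => ?_)
    have hpick := sinhSqHalfDist_map_le hf hm hz (ha n)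
    rw [← Function.iterate_succ_apply' f n z₀, sinhSqHalfDist, sinhSqHalfDist, ← div_div,
      ← div_div] at hpick
    have hfz := one_sub_norm_sq_pos (hm hz)
    have han := one_sub_norm_sq_pos (ha n)
    have han' := one_sub_norm_sq_pos (ha (n + 1))
    refine (div_le_div_iff_of_pos_right han).1 (le_trans ?_ hpick)
    exact div_le_div_of_nonneg_left (by positivity) han' (by gcongr)
  have hz1 := one_sub_norm_sq_pos hz
  have hz2 := norm_sub_pos hτ hz
  have hfz1 := one_sub_norm_sq_pos (hm hz)
  have hfz2 := norm_sub_pos hτ (hm hz)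
  rw [norm_sub_rev (f z), norm_sub_rev z, div_le_div_iff₀ hfz1 hz1] at hle
  rw [cayley_re hτ, cayley_re hτ, div_le_div_iff₀ (by positivity) (by positivity)]
  linarith

theorem IsDenjoyWolffPoint.tendsto_orbit (hτ : IsDenjoyWolffPoint φ τ) (hz : z ∈ disc) :
    Tendsto (fun t => φ t z) atTop (𝓝 τ) :=
  hτ.2.tendsto_at hz

theorem IsNonElliptic.norm_eq_one (hne : IsNonElliptic φ) (hτ : IsDenjoyWolffPoint φ τ) :
    ‖τ‖ = 1 := by
  obtain ⟨σ, hσ, hdw⟩ := hne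
  have h0 : (0 : ℂ) ∈ disc := mem_ball_self one_pos
  rw [tendsto_nhds_unique (hτ.tendsto_orbit h0) (hdw.tendsto_orbit h0)]
  exact mem_sphere_zero_iff_norm.1 hσ

theorem IsSemigroup.continuous_orbit (hφ : IsSemigroup φ) (hz : z ∈ disc) :
    Continuous fun t => φ t z :=
  continuous_iff_continuousAt.2 fun t => (hφ.cont t).tendsto_at hz

theorem IsSemigroup.iterate_eq (hφ : IsSemigroup φ) (t : ℝ≥0) (hz : z ∈ disc) (n : ℕ) :
    (φ t)^[n] z = φ (n * t) z := by
  induction n with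
  | zero => rw [Function.iterate_zero_apply, Nat.cast_zero, zero_mul, hφ.zero z hz]
  | succ n ih =>
    rw [Function.iterate_succ_apply', ih, ← hφ.add t _ z hz, Nat.cast_succ, add_one_mul, add_comm]

theorem IsSemigroup.monotone_cayley_re (hφ : IsSemigroup φ) (hτ : IsDenjoyWolffPoint φ τ)
    (hτ1 : ‖τ‖ = 1) (hz : z ∈ disc) : Monotone fun t => (cayley τ (φ t z)).re := by
  intro s t hst
  obtain ⟨r, rfl⟩ := exists_add_of_le hst
  have hsz := hφ.mapsTo s hz
  rcases eq_or_ne r 0 with rfl | hr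
  · rw [add_zero]
  have hlim : Tendsto (fun n => (φ r)^[n] z) atTop (𝓝 τ) := by
    simp only [hφ.iterate_eq r hz]
    exact (hτ.tendsto_orbit hz).comp
      (tendsto_natCast_atTop_atTop.atTop_mul_const (pos_iff_ne_zero.2 hr))
  simpa only [add_comm s r, hφ.add r s z hz] using
    cayley_re_le_cayley_re_map (hφ.holo r) (hφ.mapsTo r) hτ1 hz hlim hsz

end JuliaWolff

section SlitPlane

lemma sqrt_re_pos {w : ℂ} (hw : w ∈ Complex.slitPlane) : 0 < (Complex.sqrt w).re := by
  rw [Complex.sqrt, Complex.cpow_inv_two_re, Real.sqrt_pos]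
  refine half_pos ?_
  rcases Complex.mem_slitPlane_iff.1 hw with hre | him
  · exact add_pos_of_nonneg_of_pos (norm_nonneg w) hre
  · exact neg_lt_iff_pos_add'.1 (abs_lt.1 (Complex.abs_re_lt_norm.2 him)).1

lemma norm_sqrt_sq (w : ℂ) : ‖Complex.sqrt w‖ ^ 2 = ‖w‖ := by
  rw [← norm_pow, Complex.sqrt]
  exact congrArg norm (Complex.cpow_nat_inv_pow w two_ne_zero)

lemma norm_div_norm_le_of_re_pos {a b : ℂ} (ha : 0 < a.re) (hb : 0 < b.re)
    (hab : 2 * ‖b‖ ≤ ‖a‖) : ‖a‖ / ‖b‖ ≤ 16 * (‖a - b‖ ^ 2 / (4 * a.re * b.re)) := by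
  have hb0 : 0 < ‖b‖ := hb.trans_le (Complex.re_le_norm b)
  have hsub : ‖a‖ / 2 ≤ ‖a - b‖ := by linarith [norm_sub_norm_le a b]
  calc ‖a‖ / ‖b‖ = 16 * ((‖a‖ / 2) ^ 2 / (4 * ‖a‖ * ‖b‖)) := by field_simp; ring
    _ ≤ 16 * (‖a - b‖ ^ 2 / (4 * a.re * b.re)) := by
        gcongr <;> exact Complex.re_le_norm _

theorem norm_div_norm_le_of_mapsTo_slitPlane {f : ℂ → ℂ} {z w : ℂ} (hf : DifferentiableOn ℂ f disc)
    (hm : MapsTo f disc Complex.slitPlane) (hz : z ∈ disc) (hw : w ∈ disc)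
    (hfw : 4 * ‖f w‖ ≤ ‖f z‖) : ‖f z‖ / ‖f w‖ ≤ 256 * sinhSqHalfDist z w ^ 2 := by
  let g : ℂ → ℂ := Complex.sqrt ∘ f
  have hgd : DifferentiableOn ℂ g disc := Complex.differentiableOn_sqrt.comp hf hm
  have hg (z : ℂ) (hz : z ∈ disc) : 0 < (g z).re := sqrt_re_pos (hm hz)
  have hgsq (z : ℂ) : ‖g z‖ ^ 2 = ‖f z‖ := norm_sqrt_sq (f z)
  have hgw : 2 * ‖g w‖ ≤ ‖g z‖ := by
    refine (sq_le_sq₀ (by positivity) (norm_nonneg _)).1 ?_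
    rw [mul_pow, hgsq, hgsq]
    linarith
  calc ‖f z‖ / ‖f w‖ = (‖g z‖ / ‖g w‖) ^ 2 := by
        rw [div_pow, hgsq, hgsq]
    _ ≤ (16 * (‖g z - g w‖ ^ 2 / (4 * (g z).re * (g w).re))) ^ 2 := by
        gcongr
        exact norm_div_norm_le_of_re_pos (hg z hz) (hg w hw) hgw
    _ ≤ (16 * sinhSqHalfDist z w) ^ 2 := by
        have hzpos := hg z hz
        have hwpos := hg w hw
        gcongr
        exact norm_sub_sq_div_le_sinhSqHalfDist hgd hg hz hw
    _ = 256 * sinhSqHalfDist z w ^ 2 := by ring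

theorem image_ne_univ_of_injOn_disc {h : ℂ → ℂ} (hd : DifferentiableOn ℂ h disc)
    (hi : InjOn h disc) : h '' disc ≠ univ := by
  intro huniv
  obtain ⟨e, (hsource : e.source = disc), rfl⟩ :=
    exists_openPartialHomeomorph_of_injOn isOpen_ball hd hi
  rw [← hsource, e.image_source_eq_target] at huniv
  have hdiff : Differentiable ℂ e.symm := by
    rw [← differentiableOn_univ, ← huniv]
    exact differentiableOn_symm (hsource ▸ hd)
  have hbdd : Bornology.IsBounded (range e.symm) :=
    isBounded_ball.subset (t := disc) <| range_subset_iff.2 fun w =>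
      hsource ▸ e.map_target (huniv ▸ mem_univ w)
  have h0 : (0 : ℂ) ∈ e.source := hsource ▸ mem_ball_self one_pos
  have h1 : (1 / 2 : ℂ) ∈ e.source := hsource ▸ mem_ball_zero_iff.2 (by norm_num)
  have heq := hdiff.apply_eq_apply_of_bounded hbdd (e 0) (e (1 / 2))
  rw [e.left_inv h0, e.left_inv h1] at heq
  norm_num at heq

end SlitPlane

section Koenigs

variable {φ : ℝ≥0 → ℂ → ℂ} {h : ℂ → ℂ} {τ z w : ℂ}

theorem IsKoenigs.mem_slitPlane (hh : IsKoenigs φ h) (hφ : IsSemigroup φ) {p : ℂ}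
    (hp : p ∉ h '' disc) (hz : z ∈ disc) : -I * (h z - p) ∈ Complex.slitPlane := by
  rw [Complex.mem_slitPlane_iff_not_le_zero]
  intro hle
  obtain ⟨x, hx, hxe⟩ : ∃ x : ℝ, x ≤ 0 ∧ (x : ℂ) = -I * (h z - p) :=
    ⟨_, (Complex.le_def.1 hle).1, Complex.ext rfl (Complex.le_def.1 hle).2.symm⟩
  refine hp ⟨φ (-x).toNNReal z, hφ.mapsTo _ hz, ?_⟩
  rw [hh.conj _ z hz, Real.coe_toNNReal _ (neg_nonneg.2 hx), Complex.ofReal_neg, hxe]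
  linear_combination (h z - p) * Complex.I_sq

theorem IsKoenigs.eventually_le_sinhSqHalfDist (hh : IsKoenigs φ h) (hφ : IsSemigroup φ)
    (hz : z ∈ disc) : ∀ᶠ t in atTop, ∀ M : ℝ≥0, 9 ≤ M →
      M ≤ 1024 * sinhSqHalfDist (φ (M * t) z) (φ t z) ^ 2 := by
  obtain ⟨p, hp⟩ := (ne_univ_iff_exists_notMem _).1 (image_ne_univ_of_injOn_disc hh.holo hh.inj)
  let f : ℂ → ℂ := fun z => -I * (h z - p)
  have hfd : DifferentiableOn ℂ f disc := (hh.holo.sub_const p).const_mul (-I)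
  have hfm : MapsTo f disc Complex.slitPlane := fun z hz => hh.mem_slitPlane hφ hp hz
  have hforbit (t : ℝ≥0) : f (φ t z) = (t : ℝ) + f z := by
    simp only [f, hh.conj t z hz]
    linear_combination -((t : ℝ) : ℂ) * Complex.I_sq
  filter_upwards [eventually_ge_atTop ‖f z‖₊, eventually_gt_atTop 0] with t ht ht0 M hM
  replace ht : ‖f z‖ ≤ t := NNReal.coe_le_coe.2 ht
  replace ht0 : (0 : ℝ) < t := NNReal.coe_pos.2 ht0
  replace hM : (9 : ℝ) ≤ M := NNReal.coe_le_coe.2 hM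
  have hnorm (s : ℝ≥0) : |‖f (φ s z)‖ - s| ≤ ‖f z‖ := by
    have hle := abs_norm_sub_norm_le (f (φ s z)) ((s : ℝ) : ℂ)
    rwa [hforbit, add_sub_cancel_left, ← hforbit, Complex.norm_of_nonneg s.coe_nonneg] at hle
  have hupp : ‖f (φ t z)‖ ≤ 2 * t := by linarith [(abs_le.1 (hnorm t)).2]
  have hlow : M * t - t ≤ ‖f (φ (M * t) z)‖ := by
    have hle := (abs_le.1 (hnorm (M * t))).1
    rw [NNReal.coe_mul] at hle
    linarith
  have hMt : 9 * (t : ℝ) ≤ M * t := by gcongr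
  have hratio : (M : ℝ) / 4 ≤ ‖f (φ (M * t) z)‖ / ‖f (φ t z)‖ := by
    have hpos : 0 < ‖f (φ t z)‖ :=
      norm_pos_iff.2 (Complex.slitPlane_ne_zero (hfm (hφ.mapsTo t hz)))
    rw [le_div_iff₀ hpos]
    calc (M : ℝ) / 4 * ‖f (φ t z)‖ ≤ M / 4 * (2 * t) := by gcongr
      _ ≤ ‖f (φ (M * t) z)‖ := by linarith
  have hle := norm_div_norm_le_of_mapsTo_slitPlane hfd hfm (hφ.mapsTo (M * t) hz)
    (hφ.mapsTo t hz) (by linarith)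
  linarith

/-- The set `Ω` contains discs of linearly growing radius about the points of the upward vertical
half-line from `w`, which is the `h`-image of the trajectory of `z` if `w = h z`. -/
def HasLinearClearance (Ω : Set ℂ) (w : ℂ) : Prop :=
  ∃ c : ℝ≥0, 0 < c ∧ ∀ᶠ t : ℝ≥0 in atTop, ball (w + I * (t : ℝ)) (c * t) ⊆ Ω

theorem IsKoenigs.exists_eventually_dist_cayley_le (hh : IsKoenigs φ h) (hφ : IsSemigroup φ)
    (hτ1 : ‖τ‖ = 1) (hz : z ∈ disc) (hclear : HasLinearClearance (h '' disc) (h z)) :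
    ∃ l : ℝ≥0, 1 < l ∧ ∀ᶠ t in atTop, ∀ s ∈ Icc t (l * t),
      dist (cayley τ (φ t z)) (cayley τ (φ s z)) ≤ 2 * (cayley τ (φ t z)).re := by
  obtain ⟨c, hc, hball⟩ := hclear
  refine ⟨1 + c / 2, lt_add_of_pos_right 1 (half_pos hc), ?_⟩
  filter_upwards [hball, eventually_gt_atTop 0] with t hball ht s ⟨hts, hst⟩
  have hct : (0 : ℝ) < c * t := NNReal.coe_pos.2 (mul_pos hc ht)
  replace hts : (t : ℝ) ≤ s := hts
  replace hst : (s : ℝ) ≤ (1 + c / 2) * t := by exact_mod_cast hst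
  have hsub : ‖h (φ s z) - h (φ t z)‖ = s - t := by
    rw [hh.conj s z hz, hh.conj t z hz, add_sub_add_left_eq_sub, ← mul_sub, ← Complex.ofReal_sub,
      norm_mul, Complex.norm_I, one_mul, Complex.norm_of_nonneg (sub_nonneg.2 hts)]
  rw [← hh.conj t z hz] at hball
  have hle := norm_sub_le_of_re_pos_of_injOn isOpen_ball hh.holo hh.inj
    (differentiableOn_cayley hτ1) (fun z => cayley_re_pos hτ1) hball (hφ.mapsTo s hz)
    (hφ.mapsTo t hz) (by linarith)
  rw [hsub, mul_div_assoc] at hle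
  rw [dist_comm, dist_eq_norm]
  refine hle.trans (mul_le_of_le_one_right ?_ ?_)
  · linarith [cayley_re_pos hτ1 (hφ.mapsTo t hz)]
  · rw [div_le_one (by linarith)]
    linarith

lemma sinhSqHalfDist_le_of_dist_cayley_le (hτ1 : ‖τ‖ = 1) (hz : z ∈ disc) (hw : w ∈ disc) {n : ℝ}
    (hn : dist (cayley τ w) (cayley τ z) ≤ n * (2 * (cayley τ z).re)) :
    sinhSqHalfDist z w ≤ n ^ 2 * ((cayley τ z).re / (cayley τ w).re) := by
  have hzpos := cayley_re_pos hτ1 hz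
  have hwpos := cayley_re_pos hτ1 hw
  rw [dist_comm, dist_eq_norm] at hn
  calc sinhSqHalfDist z w
      = ‖cayley τ z - cayley τ w‖ ^ 2 / (4 * (cayley τ z).re * (cayley τ w).re) :=
        sinhSqHalfDist_eq_cayley hτ1 hz hw
    _ ≤ (n * (2 * (cayley τ z).re)) ^ 2 / (4 * (cayley τ z).re * (cayley τ w).re) := by gcongr
    _ = n ^ 2 * ((cayley τ z).re / (cayley τ w).re) := by field_simp; ring

lemma exists_mul_pow_lt_pow {l : ℝ} (hl : 1 < l) (C : ℝ) (k : ℕ) :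
    ∃ n : ℕ, 0 < n ∧ C * n ^ k < l ^ n := by
  have hlim := (tendsto_pow_const_div_const_pow_of_one_lt k hl).const_mul C
  rw [mul_zero] at hlim
  obtain ⟨n, hlt, hn⟩ := ((hlim.eventually_lt_const one_pos).and (eventually_gt_atTop 0)).exists
  rw [mul_div_assoc', div_lt_one (by positivity)] at hlt
  exact ⟨n, hn, hlt⟩

/-- The hyperbolic distance between the times `t` and `lⁿ t` of a trajectory is at least of order
`n log l`, while the bound on the steps would keep it of order `log n` if the real part did not
double. -/
theorem IsKoenigs.exists_eventually_two_mul_cayley_re_le (hh : IsKoenigs φ h)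
    (hφ : IsSemigroup φ) (hτ : IsDenjoyWolffPoint φ τ) (hτ1 : ‖τ‖ = 1) (hz : z ∈ disc) {l : ℝ≥0}
    (hl : 1 < l) (hstep : ∀ᶠ t in atTop, ∀ s ∈ Icc t (l * t),
      dist (cayley τ (φ t z)) (cayley τ (φ s z)) ≤ 2 * (cayley τ (φ t z)).re) :
    ∃ n : ℕ, 0 < n ∧
      ∀ᶠ t in atTop, 2 * (cayley τ (φ t z)).re ≤ (cayley τ (φ (l ^ n * t) z)).re := by
  obtain ⟨n, hn, hln⟩ := exists_mul_pow_lt_pow (NNReal.one_lt_coe.2 hl) 4096 4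
  refine ⟨n, hn, ?_⟩
  have hl9 : 9 ≤ l ^ n := by
    have h1n : (1 : ℝ) ≤ n ^ 4 := one_le_pow₀ (Nat.one_le_cast.2 hn)
    have : (9 : ℝ) ≤ (l : ℝ) ^ n := by linarith
    exact_mod_cast this
  obtain ⟨t₀, hstep⟩ := eventually_atTop.1 hstep
  have hmono := (hφ.monotone_cayley_re hτ hτ1 hz).const_mul zero_le_two
  filter_upwards [hh.eventually_le_sinhSqHalfDist hφ hz, eventually_ge_atTop t₀] with t hM ht
  have hzt := hφ.mapsTo t hz
  have hwt := hφ.mapsTo (l ^ n * t) hz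
  have hpos := cayley_re_pos hτ1 hzt
  have hpos' := cayley_re_pos hτ1 hwt
  have hsinh := sinhSqHalfDist_le_of_dist_cayley_le hτ1 hwt hzt
    (dist_le_natCast_mul_of_pow_mul hmono hl hstep ht n)
  have hsinh0 : 0 ≤ sinhSqHalfDist (φ (l ^ n * t) z) (φ t z) := by
    rw [sinhSqHalfDist_eq_cayley hτ1 hwt hzt]
    positivity
  by_contra! hlt
  have hratio : (cayley τ (φ (l ^ n * t) z)).re / (cayley τ (φ t z)).re ≤ 2 :=
    (div_le_iff₀ hpos).2 hlt.le
  refine hln.not_ge ?_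
  calc (l : ℝ) ^ n ≤ 1024 * sinhSqHalfDist (φ (l ^ n * t) z) (φ t z) ^ 2 := by
        simpa only [NNReal.coe_pow] using hM (l ^ n) hl9
    _ ≤ 1024 * (n ^ 2 * 2) ^ 2 := by
        gcongr
        exact hsinh.trans (by gcongr)
    _ = 4096 * n ^ 4 := by ring

theorem IsKoenigs.exists_eventually_norm_cayley_add_one_le (hh : IsKoenigs φ h)
    (hφ : IsSemigroup φ) (hτ : IsDenjoyWolffPoint φ τ) (hτ1 : ‖τ‖ = 1) (hz : z ∈ disc)
    (hclear : HasLinearClearance (h '' disc) (h z)) :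
    ∃ K : ℝ, 1 < K ∧ ∀ᶠ t in atTop, ‖cayley τ (φ t z) + 1‖ ≤ K * (cayley τ (φ t z)).re := by
  obtain ⟨l, hl, hstep⟩ := hh.exists_eventually_dist_cayley_le hφ hτ1 hz hclear
  obtain ⟨n, hn, hdouble⟩ := hh.exists_eventually_two_mul_cayley_re_le hφ hτ hτ1 hz hl hstep
  obtain ⟨t₀, ht₀⟩ := eventually_atTop.1 (hstep.and (hdouble.and (eventually_gt_atTop 0)))
  let G : ℝ≥0 → ℂ := fun t => cayley τ (φ t z)
  have hmono : Monotone fun t => (G t).re := hφ.monotone_cayley_re hτ hτ1 hz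
  have hpos : 0 < (G t₀).re := cayley_re_pos hτ1 (hφ.mapsTo t₀ hz)
  refine ⟨‖G t₀ + 1‖ / (G t₀).re + (2 * n + 1) * 2, ?_, ?_⟩
  · have hquot : 0 ≤ ‖G t₀ + 1‖ / (G t₀).re := by positivity
    linarith [n.cast_nonneg (α := ℝ)]
  filter_upwards [eventually_ge_atTop t₀] with t ht
  have hdist : dist (G t₀) (G t) ≤ (2 * n + 1) * (2 * (G t).re) :=
    dist_le_of_doubling (hmono.const_mul zero_le_two) (ht₀ t₀ le_rfl).2.2 hl
      (fun t ht => (ht₀ t ht).1) hn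
      (fun t ht => mul_le_mul_of_nonneg_left (ht₀ t ht).2.1 zero_le_two) ht
  rw [dist_comm, dist_eq_norm] at hdist
  calc ‖G t + 1‖ = ‖(G t₀ + 1) + (G t - G t₀)‖ := by ring_nf
    _ ≤ ‖G t₀ + 1‖ + ‖G t - G t₀‖ := norm_add_le _ _
    _ ≤ ‖G t₀ + 1‖ / (G t₀).re * (G t).re + (2 * n + 1) * (2 * (G t).re) := by
        refine add_le_add ?_ hdist
        rw [div_mul_eq_mul_div, le_div_iff₀ hpos]
        exact mul_le_mul_of_nonneg_left (hmono ht) (norm_nonneg _)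
    _ = (‖G t₀ + 1‖ / (G t₀).re + (2 * n + 1) * 2) * (G t).re := by ring

lemma mem_stolz_of_norm_cayley_add_one_le {K : ℝ} (hK : 0 < K) (hτ1 : ‖τ‖ = 1) (hz : z ∈ disc)
    (hle : ‖cayley τ z + 1‖ ≤ K * (cayley τ z).re) : z ∈ stolz τ K := by
  have hd := norm_sub_pos hτ1 hz
  rw [cayley_add_one hτ1 hz, norm_div, norm_one_sub_conj_mul hτ1, Complex.norm_ofNat,
    cayley_re hτ1, mul_div_assoc', div_le_div_iff₀ hd (by positivity)] at hle
  have hlt : (2 : ℝ) * ‖τ - z‖ < 2 * (K * (1 - ‖z‖)) := by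
    have hle' : 2 * ‖τ - z‖ ≤ K * (1 - ‖z‖ ^ 2) := by
      refine le_of_mul_le_mul_right ?_ hd
      linarith
    refine hle'.trans_lt ?_
    have hz1 := mem_ball_zero_iff.1 hz
    calc K * (1 - ‖z‖ ^ 2) = K * (1 - ‖z‖) * (1 + ‖z‖) := by ring
      _ < K * (1 - ‖z‖) * 2 := by
          have := mul_pos hK (sub_pos.2 hz1)
          gcongr
          linarith
      _ = 2 * (K * (1 - ‖z‖)) := by ring
  exact ⟨hz, by linarith⟩

theorem IsKoenigs.tendsToNonTangentially (hh : IsKoenigs φ h) (hφ : IsSemigroup φ)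
    (hτ : IsDenjoyWolffPoint φ τ) (hτ1 : ‖τ‖ = 1) (hz : z ∈ disc)
    (hclear : HasLinearClearance (h '' disc) (h z)) :
    TendsToNonTangentially (fun t => φ t z) τ := by
  obtain ⟨K, hK, hle⟩ := hh.exists_eventually_norm_cayley_add_one_le hφ hτ hτ1 hz hclear
  exact ⟨mem_sphere_zero_iff_norm.2 hτ1, hτ.tendsto_orbit hz, K, hK, hle.mono fun t ht =>
    mem_stolz_of_norm_cayley_add_one_le (one_pos.trans hK) hτ1 (hφ.mapsTo t hz) ht⟩

end Koenigs

section Slope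

variable {φ : ℝ≥0 → ℂ → ℂ} {h : ℂ → ℂ} {τ z w : ℂ}

lemma one_sub_norm_le_re_one_sub_conj_mul (hτ1 : ‖τ‖ = 1) (z : ℂ) :
    1 - ‖z‖ ≤ (1 - conj τ * z).re := by
  have hle := Complex.re_le_norm (conj τ * z)
  rw [norm_mul, RCLike.norm_conj, hτ1, one_mul] at hle
  rw [Complex.sub_re, Complex.one_re]
  exact sub_le_sub_left hle 1

lemma re_one_sub_conj_mul_pos (hτ1 : ‖τ‖ = 1) (hz : z ∈ disc) : 0 < (1 - conj τ * z).re :=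
  (sub_pos.2 (mem_ball_zero_iff.1 hz)).trans_le (one_sub_norm_le_re_one_sub_conj_mul hτ1 z)

lemma abs_arg_le_of_mem_stolz {R : ℝ} (hτ1 : ‖τ‖ = 1) (hz : z ∈ stolz τ R) :
    |(1 - conj τ * z).arg| ≤ Real.arccos R⁻¹ := by
  obtain ⟨hz, hlt⟩ := hz
  have hne := one_sub_conj_mul_ne_zero hτ1.le hz
  have hz1 : 0 < 1 - ‖z‖ := sub_pos.2 (mem_ball_zero_iff.1 hz)
  have hR : 0 < R := pos_of_mul_pos_left ((norm_nonneg _).trans_lt hlt) hz1.le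
  rw [← norm_one_sub_conj_mul hτ1] at hlt
  have hcos : R⁻¹ ≤ Real.cos |(1 - conj τ * z).arg| := by
    rw [Real.cos_abs, Complex.cos_arg hne, le_div_iff₀ (norm_pos_iff.2 hne), inv_mul_le_iff₀ hR]
    refine hlt.le.trans ?_
    gcongr
    exact one_sub_norm_le_re_one_sub_conj_mul hτ1 z
  simpa only [Real.arccos_cos (abs_nonneg _) (Complex.abs_arg_le_pi _)] using
    Real.arccos_le_arccos hcos

theorem IsSemigroup.continuous_arg_orbit (hφ : IsSemigroup φ) (hτ1 : ‖τ‖ = 1) (hz : z ∈ disc) :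
    Continuous fun t => (1 - conj τ * φ t z).arg := by
  have hcont := hφ.continuous_orbit hz
  refine continuous_iff_continuousAt.2 fun t =>
    ContinuousAt.comp (g := Complex.arg) ?_ (by fun_prop)
  exact Complex.continuousAt_arg (.inl (re_one_sub_conj_mul_pos hτ1 (hφ.mapsTo t hz)))

theorem IsSemigroup.exists_slope_eq_Icc (hφ : IsSemigroup φ) (hz : z ∈ disc)
    (hnt : TendsToNonTangentially (fun t => φ t z) τ) :
    ∃ a b : ℝ, -(Real.pi / 2) < a ∧ a ≤ b ∧ b < Real.pi / 2 ∧ slope φ τ z = Icc a b := by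
  obtain ⟨hτ, -, R, hR, hstolz⟩ := hnt
  have hτ1 : ‖τ‖ = 1 := mem_sphere_zero_iff_norm.1 hτ
  let f : ℝ≥0 → ℝ := fun t => (1 - conj τ * φ t z).arg
  have hf : ∀ᶠ t in atTop, |f t| ≤ Real.arccos R⁻¹ :=
    hstolz.mono fun t ht => abs_arg_le_of_mem_stolz hτ1 ht
  have hlow : ∀ᶠ t in atTop, -Real.arccos R⁻¹ ≤ f t := hf.mono fun t ht => (abs_le.1 ht).1
  have hupp : ∀ᶠ t in atTop, f t ≤ Real.arccos R⁻¹ := hf.mono fun t ht => (abs_le.1 ht).2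
  have hge := isBoundedUnder_of_eventually_ge hlow
  have hle := isBoundedUnder_of_eventually_le hupp
  have hR2 : Real.arccos R⁻¹ < Real.pi / 2 := Real.arccos_lt_pi_div_two.2 (by positivity)
  exact ⟨liminf f atTop, limsup f atTop,
    (neg_lt_neg hR2).trans_le (le_liminf_of_le hle.isCoboundedUnder_ge hlow),
    liminf_le_limsup hle hge, (limsup_le_of_le hge.isCoboundedUnder_le hupp).trans_lt hR2,
    setOf_mapClusterPt_eq_Icc atTop_basis (fun _ _ => isPreconnected_Ici)
      (hφ.continuous_arg_orbit hτ1 hz) hle hge⟩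

lemma norm_div_sub_one_le (hτ1 : ‖τ‖ = 1) (hz : z ∈ disc) (hw : w ∈ disc) :
    ‖(1 - conj τ * w) / (1 - conj τ * z) - 1‖ ≤
      ‖cayley τ z - cayley τ w‖ / (cayley τ w).re := by
  have hre : (cayley τ w).re ≤ ‖cayley τ w + 1‖ := by
    have hle := Complex.re_le_norm (cayley τ w + 1)
    rw [Complex.add_re, Complex.one_re] at hle
    linarith
  have hpos := cayley_re_pos hτ1 hw
  have hne : cayley τ w + 1 ≠ 0 := norm_pos_iff.1 (hpos.trans_le hre)
  have hquot : (1 - conj τ * w) / (1 - conj τ * z) = (cayley τ z + 1) / (cayley τ w + 1) := by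
    rw [cayley_add_one hτ1 hz, cayley_add_one hτ1 hw, div_div_div_cancel_left' _ _ two_ne_zero]
  rw [hquot, div_sub_one hne, add_sub_add_right_eq_sub, norm_div]
  gcongr

theorem IsKoenigs.tendsto_div_orbits (hh : IsKoenigs φ h) (hφ : IsSemigroup φ) (hτ1 : ‖τ‖ = 1)
    (hz : z ∈ disc) (hw : w ∈ disc) (hclear : HasLinearClearance (h '' disc) (h w)) :
    Tendsto (fun t => (1 - conj τ * φ t w) / (1 - conj τ * φ t z)) atTop (𝓝 1) := by
  obtain ⟨c, hc, hball⟩ := hclear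
  have hct : Tendsto (fun t : ℝ≥0 => (c * t : ℝ)) atTop atTop :=
    NNReal.tendsto_coe_atTop.2 (tendsto_id.const_mul_atTop hc)
  have hlim : Tendsto (fun t : ℝ≥0 => 2 * ‖h z - h w‖ / (c * t - ‖h z - h w‖)) atTop (𝓝 0) :=
    tendsto_const_nhds.div_atTop (tendsto_atTop_add_const_right _ _ hct)
  refine tendsto_iff_norm_sub_tendsto_zero.2 <|
    squeeze_zero' (.of_forall fun _ => norm_nonneg _) ?_ hlim
  filter_upwards [hball, hct.eventually_gt_atTop ‖h z - h w‖] with t hball ht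
  have hzt := hφ.mapsTo t hz
  have hwt := hφ.mapsTo t hw
  have hsub : ‖h (φ t z) - h (φ t w)‖ = ‖h z - h w‖ := by
    rw [hh.conj t z hz, hh.conj t w hw, add_sub_add_right_eq_sub]
  rw [← hh.conj t w hw] at hball
  have hle := norm_sub_le_of_re_pos_of_injOn isOpen_ball hh.holo hh.inj
    (differentiableOn_cayley hτ1) (fun z => cayley_re_pos hτ1) hball hzt hwt (by rwa [hsub])
  refine (norm_div_sub_one_le hτ1 hzt hwt).trans ?_
  rw [div_le_iff₀ (cayley_re_pos hτ1 hwt)]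
  refine hle.trans_eq ?_
  rw [hsub]
  ring

lemma arg_div_of_re_pos {a b : ℂ} (ha : 0 < a.re) (hb : 0 < b.re) :
    (a / b).arg = a.arg - b.arg := by
  have hne {c : ℂ} (hc : 0 < c.re) : c ≠ 0 := fun h0 => hc.ne' (congrArg Complex.re h0)
  have ha' := abs_lt.1 (Complex.abs_arg_lt_pi_div_two_iff.2 (.inl ha))
  have hb' := abs_lt.1 (Complex.abs_arg_lt_pi_div_two_iff.2 (.inl hb))
  have hinv : b⁻¹.arg = -b.arg := by
    rw [Complex.arg_inv, if_neg (by linarith [Real.pi_pos])]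
  rw [div_eq_mul_inv, Complex.arg_mul (hne ha) (inv_ne_zero (hne hb)), hinv, sub_eq_add_neg]
  rw [hinv]
  constructor <;> linarith

theorem IsKoenigs.slope_congr (hh : IsKoenigs φ h) (hφ : IsSemigroup φ) (hτ1 : ‖τ‖ = 1)
    (hz : z ∈ disc) (hw : w ∈ disc) (hclear : HasLinearClearance (h '' disc) (h w)) :
    slope φ τ w = slope φ τ z := by
  have harg : Tendsto (fun t => (1 - conj τ * φ t w).arg - (1 - conj τ * φ t z).arg) atTop
      (𝓝 0) := by
    have hlim := (Complex.continuousAt_arg Complex.one_mem_slitPlane).tendsto.comp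
      (hh.tendsto_div_orbits hφ hτ1 hz hw hclear)
    rw [Complex.arg_one] at hlim
    exact hlim.congr fun t => arg_div_of_re_pos (re_one_sub_conj_mul_pos hτ1 (hφ.mapsTo t hw))
      (re_one_sub_conj_mul_pos hτ1 (hφ.mapsTo t hz))
  ext y
  exact mapClusterPt_congr_of_tendsto_sub harg

end Slope

section Sector

variable {β : ℝ}

lemma ball_subset_sector (hβ : β ∈ Icc 0 Real.pi) (t : ℝ) :
    ball (t : ℂ) (Real.sin β * t) ⊆ sector β 0 := by
  intro v hv
  have hsin := Real.sin_nonneg_of_mem_Icc hβ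
  have hlt : ‖v - t‖ < Real.sin β * t := mem_ball_iff_norm.1 hv
  have ht : 0 < t := pos_of_mul_pos_right ((norm_nonneg _).trans_lt hlt) hsin
  have hlaw : ‖v - t‖ ^ 2 = ‖v‖ ^ 2 - 2 * t * v.re + t ^ 2 := by
    simp only [Complex.sq_norm, Complex.normSq_apply, Complex.sub_re, Complex.sub_im,
      Complex.ofReal_re, Complex.ofReal_im]
    ring
  have hcos : Real.cos β * ‖v‖ < v.re := by
    have hsq : ‖v - t‖ ^ 2 < (Real.sin β * t) ^ 2 := by gcongr
    rw [hlaw, mul_pow, Real.sin_sq] at hsq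
    refine lt_of_mul_lt_mul_left ?_ (mul_pos two_pos ht).le
    linarith [two_mul_le_add_sq (Real.cos β * t) ‖v‖]
  have hv0 : v ≠ 0 := by
    rintro rfl
    simp at hcos
  have harg : |v.arg| < β := by
    refine (Real.strictAntiOn_cos.lt_iff_gt hβ ⟨abs_nonneg _, Complex.abs_arg_le_pi v⟩).1 ?_
    rwa [Real.cos_abs, Complex.cos_arg hv0, lt_div_iff₀ (norm_pos_iff.2 hv0)]
  exact ⟨‖v‖, v.arg, norm_pos_iff.2 hv0, harg, by rw [mul_comm I, Complex.norm_mul_exp_arg_mul_I]⟩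

theorem hasLinearClearance_of_sector_subset {Ω : Set ℂ} {q : ℂ} (hβ : β ∈ Ioo 0 Real.pi)
    (hq : (fun w => q + I * w) '' sector β 0 ⊆ Ω) (w : ℂ) : HasLinearClearance Ω w := by
  have hsin := Real.sin_pos_of_mem_Ioo hβ
  refine ⟨(Real.sin β / 2).toNNReal, Real.toNNReal_pos.2 (half_pos hsin), ?_⟩
  have hlim : Tendsto (fun t : ℝ≥0 => Real.sin β / 2 * (t : ℝ)) atTop atTop :=
    (NNReal.tendsto_coe_atTop.2 tendsto_id).const_mul_atTop (half_pos hsin)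
  filter_upwards [hlim.eventually_ge_atTop (dist w q)] with t ht
  rw [Real.coe_toNNReal _ (half_pos hsin).le]
  have hball : ball (w + I * (t : ℝ)) (Real.sin β / 2 * t) ⊆
      ball (q + I * (t : ℝ)) (Real.sin β * t) :=
    ball_subset_ball' (by rw [dist_add_right]; linarith)
  refine hball.trans fun v hv => hq ⟨-I * (v - q), ball_subset_sector ⟨hβ.1.le, hβ.2.le⟩ t ?_, ?_⟩
  · rw [mem_ball_iff_norm] at hv ⊢
    have hrot : -I * (v - q) - (t : ℝ) = -I * (v - (q + I * (t : ℝ))) := by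
      linear_combination -((t : ℝ) : ℂ) * Complex.I_sq
    rwa [hrot, norm_mul, norm_neg, Complex.norm_I, one_mul]
  · linear_combination -(v - q) * Complex.I_sq

end Sector

end DiscSemigroup

open DiscSemigroup in
theorem corollary1p2 (φ : ℝ≥0 → ℂ → ℂ) (h : ℂ → ℂ) (τ : ℂ)
    (hφ : DiscSemigroup.IsSemigroup φ)
    (hne : DiscSemigroup.IsNonElliptic φ)
    (hτ : DiscSemigroup.IsDenjoyWolffPoint φ τ)
    (hh : DiscSemigroup.IsKoenigs φ h)
    (β : ℝ) (hβ : β ∈ Set.Ioo 0 (Real.pi / 2)) (q : ℂ)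
    (hq : (fun w : ℂ => q + Complex.I * w) '' DiscSemigroup.sector β 0 ⊆
      h '' DiscSemigroup.disc) :
    (∀ z ∈ DiscSemigroup.disc,
      DiscSemigroup.TendsToNonTangentially (fun t => φ t z) τ) ∧
    ∃ a b : ℝ, -(Real.pi / 2) < a ∧ a ≤ b ∧ b < Real.pi / 2 ∧
      ∀ z ∈ DiscSemigroup.disc, DiscSemigroup.slope φ τ z = Set.Icc a b := by
  have hτ1 : ‖τ‖ = 1 := hne.norm_eq_one hτ
  have hclear (w : ℂ) : HasLinearClearance (h '' disc) w :=
    hasLinearClearance_of_sector_subset ⟨hβ.1, hβ.2.trans (half_lt_self Real.pi_pos)⟩ hq w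
  have hnt (z : ℂ) (hz : z ∈ disc) : TendsToNonTangentially (fun t => φ t z) τ :=
    hh.tendsToNonTangentially hφ hτ hτ1 hz (hclear (h z))
  have h0 : (0 : ℂ) ∈ disc := Metric.mem_ball_self one_pos
  obtain ⟨a, b, ha, hab, hb, hslope⟩ := hφ.exists_slope_eq_Icc h0 (hnt 0 h0)
  exact ⟨hnt, a, b, ha, hab, hb, fun z hz =>
    (hh.slope_congr hφ hτ1 h0 hz (hclear (h z))).trans hslope⟩
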